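/- **Setting.** All vector spaces are real; a Fréchet space is a Hausdorff, locally convex, metrizable and complete topological vector space. Let $X$ and $Z$ be Fréchet spaces and let $C\subseteq Z$ be a nonempty convex cone, i.e. $tC\subseteq C$ for all $t\ge 0$ and $C+C\subseteq C$ (so $0\in C$). Write $z_1\leq_C z_2$ if $z_2-z_1\in C$. Let $Z^\bullet=Z\cup\{\infty_C\}$, where $a\leq_C\infty_C$ for all $a\in Z^\bullet$, $\infty_C\not\leq_C z$ for $z\in Z$, $a+\infty_C=\infty_C+a=\infty_C$ for all $a\in Z^\bullet$, and $t\,\infty_C=\infty_C$ for all $t\ge 0$. For $f:X\to\overline{\mathbb R}=\mathbb R\cup\{\pm\infty\}$ put $\operatorname{dom} f=\{x: f(x)<+\infty\}$; $f$ is *proper* if $\operatorname{dom} f\ne\emptyset$ and $f>-\infty$ everywhere. Convexity of $f$ means $f(tx+(1-t)y)\le tf(x)+(1-t)f(y)$ for all $x,y\in X$, $t\in[0,1]$, with the conventions $(+\infty)+(-\infty)=+\infty$, $0\cdot(+\infty)=+\infty$, $0\cdot(-\infty)=0$. For $g:X\to Z^\bullet$ put $\operatorname{dom} g=\{x: g(x)\in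 Z\}$; $g$ is *proper* if $\operatorname{dom} g\neq\emptyset$, *$C$-convex* if $g(tx+(1-t)y)\leq_C tg(x)+(1-t)g(y)$ for all $x,y\in X$, $t\in[0,1]$, and *$C$-epi closed* if $\{(x,z)\in X\times Z: g(x)\leq_C z\}$ is closed in $X\times Z$. For a convex subset $U$ of a Hausdorff locally convex space $E$ let $\operatorname{cone}(U)=\bigcup_{t\ge0}tU$ and $$\operatorname{core}(U)=\{x\in U:\operatorname{cone}(U-x)=E\},\qquad \operatorname{qi}(U)=\{x\in U:\operatorname{cl}(\operatorname{cone}(U-x))=E\},$$ $$\operatorname{qri}(U)=\{x\in U:\operatorname{cl}(\operatorname{cone}(U-x))\text{ is a linear subspace of }E\}.$$ **Proposition.** Let $S\subseteq X$ be nonempty, convex and closed, let $f:X\to\overline{\mathbb R}$ be proper, convex and lower semicontinuous, and let $g:X\to Z^\bullet$ be proper, $C$-convex and $C$-epi closed. Assume that $\operatorname{dom} f\cap S\cap g^{-1}(-C)\neq\emptyset$ and that the optimal value $$v=\inf\{f(x): x\in S,\ g(x)\in -C\}$$ is a real number. Put $$M=g(\operatorname{dom} f\cap S\cap\operatorname{dom}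 g)+C,$$ $$\mathcal E_v=\{(g(x)+z,\ f(x)-v+\varepsilon): x\in\operatorname{dom} f\cap S\cap\operatorname{dom} g,\ z\in C,\ \varepsilon\ge 0\}\subseteq Z\times\mathbb R,$$ and consider the conditions - $(RC_1^L)$: there is $x'\in\operatorname{dom} f\cap S$ with $g(x')\in-\operatorname{int}(C)$; - $(RC_2^L)$: $X$ and $Z$ are Fréchet spaces, $S$ is closed, $f$ is lower semicontinuous, $g$ is $C$-epi closed and $0\in\operatorname{int}(M)$; - $(RC_3^L)$: $X$ and $Z$ are Fréchet spaces, $S$ is closed, $f$ is lower semicontinuous, $g$ is $C$-epi closed and $0\in\operatorname{core}(M)$; - $(RC_6^L)$: $0\in\operatorname{qi}(M)$ and $(0,0)\notin\operatorname{qri}\big[\operatorname{co}(\mathcal E_v\cup\{(0,0)\})\big]$; - $(RC_7^L)$: $0\in\operatorname{qi}(M-M)$, $0\in\operatorname{qri}(M)$ and $(0,0)\notin\operatorname{qri}\big[\operatorname{co}(\mathcal E_v\cup\{(0,0)\})\big]$. Then $$(RC_1^L)\Rightarrow(RC_2^L)\Leftrightarrow(RC_3^L)\Rightarrow(RC_6^L)\Leftrightarrow(RC_7^L).$$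 -/

import Mathlib

open Set Topology
open scoped Pointwise

namespace LagrangeQri

/-- A real Fréchet space: a Hausdorff locally convex topological vector space which is first
countable (equivalently, metrizable) and complete for its canonical uniformity. -/
class FrechetSpace (E : Type*) [AddCommGroup E] [Module ℝ E] [UniformSpace E] : Prop extends
    IsUniformAddGroup E, ContinuousSMul ℝ E, LocallyConvexSpace ℝ E, T2Space E,
    FirstCountableTopology E, CompleteSpace E

section Interiors

variable {E : Type*} [AddCommGroup E] [Module ℝ E]

/-- The conic hull `⋃ t ≥ 0, t • U`. -/
def conicHull (U : Set E) : Set E := ⋃ t ∈ Ici (0 : ℝ), t • U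

/-- The algebraic interior of `U`. -/
def core (U : Set E) : Set E := {x | x ∈ U ∧ conicHull (U - {x}) = univ}

/-- The quasi interior of `U`. -/
def qi [TopologicalSpace E] (U : Set E) : Set E :=
  {x | x ∈ U ∧ closure (conicHull (U - {x})) = univ}

/-- The quasi-relative interior of `U`. -/
def qri [TopologicalSpace E] (U : Set E) : Set E :=
  {x | x ∈ U ∧ ∃ L : Submodule ℝ E, closure (conicHull (U - {x})) = (L : Set E)}

end Interiors

section ExtendedReal

variable {X : Type*}

/-- Addition of extended reals with the convention `(+∞) + (-∞) = +∞`. -/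
noncomputable def convAdd (a b : EReal) : EReal :=
  open Classical in if a = ⊤ ∨ b = ⊤ then ⊤ else a + b

/-- Product of a nonnegative real and an extended real, with the conventions
`0 · (+∞) = +∞` and `0 · (-∞) = 0`. -/
noncomputable def convMul (t : ℝ) (a : EReal) : EReal :=
  open Classical in if a = ⊤ then ⊤ else (t : EReal) * a

/-- Convexity of an extended-real-valued function. -/
def IsConvex [AddCommGroup X] [Module ℝ X] (f : X → EReal) : Prop :=
  ∀ x y : X, ∀ t ∈ Icc (0 : ℝ) 1,
    f (t • x + (1 - t) • y) ≤ convAdd (convMul t (f x)) (convMul (1 - t) (f y))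

/-- The domain of an extended-real-valued function. -/
def dom (f : X → EReal) : Set X := {x | f x < ⊤}

/-- Properness of an extended-real-valued function. -/
def IsProper (f : X → EReal) : Prop := (dom f).Nonempty ∧ ∀ x, ⊥ < f x

end ExtendedReal

/-! Vector functions take values in `WithTop Z`, that is `Z` with a largest element `⊤` added;
the addition of `WithTop Z` satisfies `y + ⊤ = ⊤ + y = ⊤`. -/
section VectorFunctions

variable {X Z : Type*} [AddCommGroup Z] [Module ℝ Z]

/-- Multiplication by a nonnegative scalar, with `t · ⊤ = ⊤` (also for `t = 0`). -/
def scale (t : ℝ) (a : WithTop Z) : WithTop Z := a.map (fun z => t • z)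

/-- The ordering induced by `C`, with `⊤` as largest element. -/
def LeC (C : PointedCone ℝ Z) (a b : WithTop Z) : Prop :=
  b = ⊤ ∨ ∃ y₁ y₂ : Z, a = y₁ ∧ b = y₂ ∧ y₂ - y₁ ∈ C

/-- The domain of a vector function. -/
def vdom (g : X → WithTop Z) : Set X := {x | ∃ z : Z, g x = z}

/-- The `C`-epigraph of a vector function. -/
def epiC (C : PointedCone ℝ Z) (g : X → WithTop Z) : Set (X × Z) :=
  {p | LeC C (g p.1) (p.2 : WithTop Z)}

/-- `C`-convexity of a vector function. -/
def IsCConvex [AddCommGroup X] [Module ℝ X] (C : PointedCone ℝ Z) (g : X → WithTop Z) : Prop :=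
  ∀ x y : X, ∀ t ∈ Icc (0 : ℝ) 1,
    LeC C (g (t • x + (1 - t) • y)) (scale t (g x) + scale (1 - t) (g y))

/-- `C`-epi closedness of a vector function. -/
def IsCEpiClosed [TopologicalSpace X] [TopologicalSpace Z] (C : PointedCone ℝ Z)
    (g : X → WithTop Z) : Prop :=
  IsClosed (epiC C g)

/-- The set `g(A) ∩ Z`, which is `g(A)` when `A` is contained in the domain of `g`. -/
def vimage (g : X → WithTop Z) (A : Set X) : Set Z := {z | ∃ x ∈ A, g x = z}

/-- The preimage of `D ⊆ Z` under `g`. -/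
def vpreimage (g : X → WithTop Z) (D : Set Z) : Set X := {x | ∃ z ∈ D, g x = z}

end VectorFunctions

section Problem

variable {X Z : Type*} [AddCommGroup Z] [Module ℝ Z]

/-- The feasible set `T = {x ∈ S : g(x) ∈ -C}`. -/
def feasible (C : PointedCone ℝ Z) (S : Set X) (g : X → WithTop Z) : Set X :=
  S ∩ vpreimage g (-(C : Set Z))

/-- The optimal value of minimizing `f` over the feasible set. -/
noncomputable def primalValue (C : PointedCone ℝ Z) (S : Set X) (f : X → EReal)
    (g : X → WithTop Z) : EReal :=
  ⨅ x ∈ feasible C S g, f x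

/-- The set `g(dom f ∩ S ∩ dom g) + C`. -/
def constraintRange (C : PointedCone ℝ Z) (S : Set X) (f : X → EReal) (g : X → WithTop Z) :
    Set Z :=
  vimage g (dom f ∩ S ∩ vdom g) + (C : Set Z)

/-- The set of the pairs `(g(x) + z, f(x) - v + ε)` with `x ∈ dom f ∩ S ∩ dom g`, `z ∈ C`
and `ε ≥ 0`. -/
def conicExtension (C : PointedCone ℝ Z) (S : Set X) (f : X → EReal) (g : X → WithTop Z)
    (v : ℝ) : Set (Z × ℝ) :=
  {p | ∃ x ∈ dom f ∩ S ∩ vdom g, ∃ y : Z, g x = y ∧ ∃ z ∈ C, ∃ ε : ℝ, 0 ≤ ε ∧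
    p.1 = y + z ∧ (p.2 : EReal) = f x - (v : EReal) + (ε : EReal)}

/-- The Slater condition. -/
def RC1 [TopologicalSpace Z] (C : PointedCone ℝ Z) (S : Set X) (f : X → EReal)
    (g : X → WithTop Z) : Prop :=
  ∃ x ∈ dom f ∩ S, ∃ z ∈ -interior (C : Set Z), g x = z

/-- The condition expressed by means of the interior. -/
def RC2 [AddCommGroup X] [Module ℝ X] [UniformSpace X] [UniformSpace Z] (C : PointedCone ℝ Z)
    (S : Set X) (f : X → EReal) (g : X → WithTop Z) : Prop :=
  FrechetSpace X ∧ FrechetSpace Z ∧ IsClosed S ∧ LowerSemicontinuous f ∧ IsCEpiClosed C g ∧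
    (0 : Z) ∈ interior (constraintRange C S f g)

/-- The condition expressed by means of the algebraic interior. -/
def RC3 [AddCommGroup X] [Module ℝ X] [UniformSpace X] [UniformSpace Z] (C : PointedCone ℝ Z)
    (S : Set X) (f : X → EReal) (g : X → WithTop Z) : Prop :=
  FrechetSpace X ∧ FrechetSpace Z ∧ IsClosed S ∧ LowerSemicontinuous f ∧ IsCEpiClosed C g ∧
    (0 : Z) ∈ core (constraintRange C S f g)

/-- The condition expressed by means of the quasi interior; `v` is the optimal value. -/
def RC6 [TopologicalSpace Z] (C : PointedCone ℝ Z) (S : Set X) (f : X → EReal)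
    (g : X → WithTop Z) (v : ℝ) : Prop :=
  (0 : Z) ∈ qi (constraintRange C S f g) ∧
    ((0, 0) : Z × ℝ) ∉ qri (convexHull ℝ (conicExtension C S f g v ∪ {(0, 0)}))

/-- The condition expressed by means of the quasi-relative interior; `v` is the optimal value. -/
def RC7 [TopologicalSpace Z] (C : PointedCone ℝ Z) (S : Set X) (f : X → EReal)
    (g : X → WithTop Z) (v : ℝ) : Prop :=
  (0 : Z) ∈ qi (constraintRange C S f g - constraintRange C S f g) ∧
    (0 : Z) ∈ qri (constraintRange C S f g) ∧
    ((0, 0) : Z × ℝ) ∉ qri (convexHull ℝ (conicExtension C S f g v ∪ {(0, 0)}))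

end Problem

end LagrangeQri

open LagrangeQri

/-!
The set `𝓔 = conicExtension C S f g v` is the projection to `Z × ℝ` of a closed convex subset of
`X × (Z × ℝ)`, the joint epigraph of `f - v` and `g`. By the Robinson–Ursescu theorem its core
consists of interior points: the closures of the images of convex neighborhoods are neighborhoods
because `Z × ℝ` is barrelled, and halving the error at each step, a geometric series in the
complete space `X` removes the closure.

Since `𝓔` is upward closed in the real coordinate, a point `z` of the core of its projection
`constraintRange C S f g` lifts to a point `(z, r)` of the core of `𝓔`; hence the core of the
constraint range also consists of interior points. If `(0, 0)` were a quasi-relative interior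
point of the hull of `𝓔 ∪ {(0, 0)}`, it would be an interior point, as the hull has nonempty
interior. The hull would then contain some `(0, -t)` with `t > 0`, and so would a multiple of `𝓔`,
contradicting the minimality of `v`. For a set `M` whose cone based at one of its points has a
subspace `L` as closure, `M - M ⊆ L`, which relates `qi (M - M)` to `qi M`.
-/

namespace LagrangeQri

open Filter

section Interiors

variable {E : Type*} [AddCommGroup E] [Module ℝ E] {U V : Set E} {x : E}

theorem mem_conicHull : x ∈ conicHull U ↔ ∃ t : ℝ, 0 ≤ t ∧ ∃ u ∈ U, t • u = x := by
  simp [conicHull, mem_smul_set]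

theorem conicHull_mono (h : U ⊆ V) : conicHull U ⊆ conicHull V :=
  biUnion_mono Subset.rfl fun _ _ => smul_set_mono h

theorem subset_conicHull (U : Set E) : U ⊆ conicHull U := fun u hu =>
  mem_conicHull.2 ⟨1, zero_le_one, u, hu, one_smul ℝ u⟩

theorem conicHull_subset_submodule {L : Submodule ℝ E} (h : U ⊆ L) : conicHull U ⊆ L :=
  iUnion₂_subset fun t _ => smul_set_subset_iff.2 fun _ hu => L.smul_mem t (h hu)

theorem mem_core : x ∈ core U ↔ ∀ v : E, ∃ t : ℝ, 0 < t ∧ x + t • v ∈ U := by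
  constructor
  · rintro ⟨hx, hU⟩ v
    obtain ⟨t, ht, w, hw, rfl⟩ := mem_conicHull.1 (hU ▸ mem_univ v)
    obtain ⟨u, hu, rfl⟩ : ∃ u ∈ U, u - x = w := by simpa using hw
    obtain rfl | ht := ht.eq_or_lt
    · exact ⟨1, one_pos, by simpa using hx⟩
    · exact ⟨t⁻¹, inv_pos.2 ht, by simpa [inv_smul_smul₀ ht.ne'] using hu⟩
  · refine fun h => ⟨by simpa using (h 0).choose_spec.2, eq_univ_of_forall fun v => ?_⟩
    obtain ⟨t, ht, hv⟩ := h v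
    exact mem_conicHull.2 ⟨t⁻¹, (inv_pos.2 ht).le, t • v, ⟨_, hv, x, rfl, add_sub_cancel_left _ _⟩,
      inv_smul_smul₀ ht.ne' v⟩

theorem core_mono (h : U ⊆ V) : core U ⊆ core V := fun _ hx =>
  mem_core.2 fun v => (mem_core.1 hx v).imp fun _ ht => ht.imp_right fun hU => h hU

theorem core_subset : core U ⊆ U := fun _ hx => hx.1

theorem eventually_add_smul_mem_of_mem_core (hU : Convex ℝ U) (hx : x ∈ core U)
    (v : E) : ∀ᶠ c : ℝ in 𝓝 0, x + c • v ∈ U := by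
  have hline : Convex ℝ {c : ℝ | x + c • v ∈ U} :=
    (hU.translate_preimage_right x).linear_preimage (LinearMap.toSpanSingleton ℝ E v)
  obtain ⟨t, ht, htU⟩ := mem_core.1 hx v
  obtain ⟨s, hs, hsU⟩ := mem_core.1 hx (-v)
  filter_upwards [Icc_mem_nhds (neg_lt_zero.2 hs) ht]
  exact hline.ordConnected.out (by simpa using hsU) htU

variable [TopologicalSpace E]

theorem core_subset_qi : core U ⊆ qi U := fun _ hx => ⟨hx.1, by rw [hx.2, closure_univ]⟩

theorem mem_qi_iff_zero_mem_qi_sub_and_mem_qri : x ∈ qi U ↔ 0 ∈ qi (U - U) ∧ x ∈ qri U := by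
  rw [qi, qi, mem_ofPred_eq, mem_ofPred_eq, singleton_zero, sub_zero]
  constructor
  · rintro ⟨hx, hU⟩
    refine ⟨⟨⟨x, hx, x, hx, sub_self x⟩, eq_univ_of_univ_subset ?_⟩, hx, ⊤, hU⟩
    rw [← hU]
    exact closure_mono (conicHull_mono (sub_subset_sub_left (singleton_subset_iff.2 hx)))
  · rintro ⟨⟨-, hU⟩, hx, L, hL⟩
    have hUL : U - {x} ⊆ L := hL ▸ (subset_conicHull _).trans subset_closure
    have hdiff : U - U ⊆ L := by
      rintro _ ⟨a, ha, b, hb, rfl⟩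
      simpa using L.sub_mem (hUL (sub_mem_sub ha rfl)) (hUL (sub_mem_sub hb rfl))
    have hLc : IsClosed (L : Set E) := hL ▸ isClosed_closure
    refine ⟨hx, eq_univ_of_univ_subset ?_⟩
    rw [hL, ← hU]
    exact closure_minimal (conicHull_subset_submodule hdiff) hLc

theorem mem_nhds_zero_of_absorbent [ContinuousConstSMul ℝ E] [BarrelledSpace ℝ E] {B : Set E}
    (hB : Convex ℝ B) (hBc : IsClosed B) (hbal : Balanced ℝ B) (habs : Absorbent ℝ B) :
    B ∈ 𝓝 0 := by
  let p := gaugeSeminorm hbal hB habs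
  have hlsc : LowerSemicontinuous p := lowerSemicontinuous_iff_isClosed_preimage.2 fun r => by
    change IsClosed {v | gauge B v ≤ r}
    obtain hr | hr := lt_or_ge r 0
    · simp [(gauge_nonneg _).trans_lt' hr |>.not_ge]
    · rw [setOfPred_gauge_le_eq hB habs.zero_mem habs hr]
      exact isClosed_iInter fun s => isClosed_iInter fun hs =>
        hBc.smul_of_ne_zero (hr.trans_lt hs).ne'
  have hp : Continuous p := p.continuous_of_lowerSemicontinuous hlsc
  filter_upwards [(hp.tendsto' 0 0 (map_zero p)).eventually_lt_const one_pos] with v hv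
  exact setOfPred_gauge_lt_one_subset_self hB habs.zero_mem habs hv

variable [IsTopologicalAddGroup E] [ContinuousSMul ℝ E]

theorem interior_subset_core : interior U ⊆ core U := by
  refine fun x hx => mem_core.2 fun v => ?_
  have hlim : Tendsto (fun t : ℝ => x + t • v) (𝓝 0) (𝓝 x) :=
    Continuous.tendsto' (by fun_prop) _ _ (by simp)
  have hU := hlim.eventually (mem_interior_iff_mem_nhds.1 hx)
  have hpos : ∀ᶠ t : ℝ in 𝓝[>] 0, 0 < t := eventually_mem_nhdsWithin
  exact (hpos.and (hU.filter_mono nhdsWithin_le_nhds)).exists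

theorem qri_subset_interior (hU : Convex ℝ U) (hne : (interior U).Nonempty) :
    qri U ⊆ interior U := by
  rintro x ⟨-, L, hL⟩
  obtain ⟨u, hu⟩ := hne
  have huL : x - u ∈ closure (conicHull (U - {x})) := by
    rw [hL, SetLike.mem_coe, ← neg_sub, neg_mem_iff, ← SetLike.mem_coe, ← hL]
    exact subset_closure (subset_conicHull _ ⟨u, interior_subset hu, x, rfl, rfl⟩)
  -- The open set `x - interior U` meets the cone: `x - u' = t (w - x)`, so `x` lies between
  -- `u'` and `w`.
  obtain ⟨y, hyU, hy⟩ := mem_closure_iff.1 huL ((x - ·) ⁻¹' interior U)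
    (isOpen_interior.preimage (by fun_prop)) (by simpa using hu)
  obtain ⟨t, ht, v, hv, rfl⟩ := mem_conicHull.1 hy
  obtain ⟨w, hw, rfl⟩ : ∃ w ∈ U, w - x = v := by simpa using hv
  have hx := hU.combo_interior_self_mem_interior hyU hw (a := 1 / (1 + t)) (b := t / (1 + t))
    (by positivity) (by positivity) (by field_simp)
  convert! hx
  match_scalars <;> field_simp <;> ring

theorem core_subset_interior_of_isClosed [BarrelledSpace ℝ E] {A : Set E}
    (hA : Convex ℝ A) (hAc : IsClosed A) :
    core A ⊆ interior A := by
  intro x hx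
  let A' := (x + ·) ⁻¹' A
  have hA' : Convex ℝ A' := hA.translate_preimage_right x
  have hA'c : IsClosed A' := hAc.preimage (continuous_const_add x)
  have hbal : Balanced ℝ (A' ∩ -A') := (balanced_iff_neg_mem (hA'.inter hA'.neg)).2 fun v hv =>
    ⟨hv.2, by simpa using hv.1⟩
  have habs : Absorbent ℝ (A' ∩ -A') := absorbent_iff_eventually_nhdsNE_zero.2 fun v => by
    filter_upwards [nhdsWithin_le_nhds (eventually_add_smul_mem_of_mem_core hA hx v),
      nhdsWithin_le_nhds (eventually_add_smul_mem_of_mem_core hA hx (-v))] with c hc hc'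
    exact ⟨hc, by simpa [A'] using hc'⟩
  have hnhds := mem_nhds_zero_of_absorbent (hA'.inter hA'.neg) (hA'c.inter hA'c.neg) hbal habs
  rw [mem_interior_iff_mem_nhds, ← map_add_left_nhds_zero, mem_map]
  exact mem_of_superset hnhds inter_subset_left

end Interiors

section Series

variable {E : Type*} [AddCommGroup E] [Module ℝ E]

theorem geometric_sum_add_smul_mem {W : Set E} (hW : Convex ℝ W) {e : ℕ → E}
    (he : ∀ n, e n ∈ W) (n : ℕ) {w : E} (hw : w ∈ W) :
    ∑ k ∈ Finset.range n, (1 / 2 : ℝ) ^ (k + 1) • e k + (1 / 2 : ℝ) ^ n • w ∈ W := by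
  induction n generalizing w with
  | zero => simpa using hw
  | succ n ih =>
    have hmid : (1 / 2 : ℝ) • e n + (1 / 2 : ℝ) • w ∈ W :=
      hW (he n) hw (by norm_num) (by norm_num) (by norm_num)
    convert! ih hmid using 1
    rw [Finset.sum_range_succ]
    module

theorem exists_geometric_approximation [TopologicalSpace E] [IsTopologicalAddGroup E]
    [ContinuousConstSMul ℝ E] {R : ℕ → Set E} (hR : ∀ n, closure (R n) ∈ 𝓝 0) {b : E}
    (hb : b ∈ closure (R 0)) :
    ∃ w : ℕ → E, (∀ n, w n ∈ R n) ∧ ∀ n, ∃ c ∈ closure (R n),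
      ∑ k ∈ Finset.range n, (1 / 2 : ℝ) ^ (k + 1) • w k + (1 / 2 : ℝ) ^ (n + 1) • c =
        (1 / 2 : ℝ) • b := by
  have hstep (n : ℕ) (c : closure (R n)) :
      ∃ w ∈ R n, (2 : ℝ) • (c.1 - w) ∈ closure (R (n + 1)) := by
    have hlim : Tendsto (fun w => (2 : ℝ) • (c.1 - w)) (𝓝 c.1) (𝓝 0) :=
      Continuous.tendsto' (by fun_prop) _ _ (by simp)
    obtain ⟨w, hwR, hw⟩ := mem_closure_iff_nhds.1 c.2 _ (hlim (hR (n + 1)))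
    exact ⟨w, hw, hwR⟩
  choose f hfR hf using hstep
  let c : ∀ n, closure (R n) := Nat.rec ⟨b, hb⟩ fun n c => ⟨(2 : ℝ) • (c.1 - f n c), hf n c⟩
  refine ⟨fun n => f n (c n), fun n => hfR n (c n), fun n => ⟨(c n).1, (c n).2, ?_⟩⟩
  induction n with
  | zero => simp [c]
  | succ n ih =>
    have hc : (c (n + 1)).1 = (2 : ℝ) • ((c n).1 - f n (c n)) := rfl
    rw [← ih, Finset.sum_range_succ, hc]
    module

theorem exists_convex_nhds_zero_forall_tendsto_sum {Y : Type*} [AddCommGroup Y] [Module ℝ Y]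
    [UniformSpace Y] [IsUniformAddGroup Y] [LocallyConvexSpace ℝ Y]
    [FirstCountableTopology Y] [CompleteSpace Y] :
    ∃ U : ℕ → Set Y, (∀ n, U n ∈ 𝓝 0 ∧ Convex ℝ (U n)) ∧ ∀ u : ℕ → Y, (∀ n, u n ∈ U n) →
      Tendsto u atTop (𝓝 0) ∧
        ∃ a, Tendsto (fun n => ∑ k ∈ Finset.range n, u k) atTop (𝓝 a) := by
  have : (uniformity Y).IsCountablyGenerated := IsUniformAddGroup.uniformity_countably_generated
  let _ : PseudoMetricSpace Y := UniformSpace.pseudoMetricSpace Y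
  have hexists (n : ℕ) : ∃ U : Set Y, (U ∈ 𝓝 0 ∧ Convex ℝ U) ∧
      ∀ u ∈ U, ∀ s : Y, dist s (s + u) ≤ 1 / 2 / 2 ^ n := by
    have hdist := Metric.dist_mem_uniformity (α := Y) (show (0 : ℝ) < 1 / 2 / 2 ^ n by positivity)
    rw [uniformity_eq_comap_nhds_zero Y, mem_comap] at hdist
    obtain ⟨V, hV, hVn⟩ := hdist
    obtain ⟨U, hU, hUV⟩ := (LocallyConvexSpace.convex_basis_zero ℝ Y).mem_iff.1 hV
    refine ⟨U, hU, fun u hu s => le_of_lt ?_⟩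
    exact hVn (show (s, s + u).2 - (s, s + u).1 ∈ V by simpa using hUV hu)
  choose U hU hUdist using hexists
  refine ⟨U, hU, fun u hu => ?_⟩
  have hcauchy : CauchySeq fun n => ∑ k ∈ Finset.range n, u k :=
    cauchySeq_of_le_geometric_two (C := 1) fun n => by
      simpa only [Finset.sum_range_succ] using hUdist n (u n) (hu n) _
  obtain ⟨a, ha⟩ := cauchySeq_tendsto_of_complete hcauchy
  refine ⟨?_, a, ha⟩
  simpa [Finset.sum_range_succ] using ((tendsto_add_atTop_iff_nat 1).2 ha).sub ha

end Series

section RobinsonUrsescu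

variable {Y Z : Type*} [AddCommGroup Y] [Module ℝ Y] [AddCommGroup Z] [Module ℝ Z]
  {W : Set (Y × Z)}

theorem zero_mem_core_image_snd_inter [TopologicalSpace Y] [ContinuousSMul ℝ Y]
    (hW : Convex ℝ W) (h0 : (0 : Y × Z) ∈ W) (hcore : 0 ∈ core (Prod.snd '' W)) {V : Set Y}
    (hV : V ∈ 𝓝 0) : 0 ∈ core (Prod.snd '' (W ∩ Prod.fst ⁻¹' V)) := by
  refine mem_core.2 fun z => ?_
  obtain ⟨t, ht, ⟨y, _⟩, hyz, rfl⟩ := mem_core.1 hcore z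
  have hcont : Continuous fun s : ℝ => s • y := by fun_prop
  have hsmall : ∀ᶠ s : ℝ in 𝓝[>] 0, s • y ∈ V :=
    nhdsWithin_le_nhds ((hcont.tendsto' 0 0 (zero_smul ℝ y)).eventually hV)
  obtain ⟨s, hsV, hs0, hs1⟩ := (hsmall.and (Ioo_mem_nhdsGT (zero_lt_one' ℝ))).exists
  exact ⟨s * t, mul_pos hs0 ht, (s • y, 0 + (s * t) • z),
    ⟨by simpa [mul_smul] using hW.smul_mem_of_zero_mem h0 hyz ⟨hs0.le, hs1.le⟩, hsV⟩, rfl⟩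

theorem half_smul_closure_image_snd_subset [TopologicalSpace Y] [ContinuousAdd Y]
    [TopologicalSpace Z] [IsTopologicalAddGroup Z] [ContinuousConstSMul ℝ Z] (hW : Convex ℝ W)
    (hWc : IsClosed W) (h0 : (0 : Y × Z) ∈ W) {U : ℕ → Set Y} (hU : ∀ n, StarConvex ℝ 0 (U n))
    (hUsum : ∀ u : ℕ → Y, (∀ n, u n ∈ U n) → Tendsto u atTop (𝓝 0) ∧
      ∃ a, Tendsto (fun n => ∑ k ∈ Finset.range n, u k) atTop (𝓝 a))
    (hR : ∀ n, closure (Prod.snd '' (W ∩ Prod.fst ⁻¹' U n)) ∈ 𝓝 0) :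
    (1 / 2 : ℝ) • closure (Prod.snd '' (W ∩ Prod.fst ⁻¹' U 0)) ⊆ Prod.snd '' W := by
  rintro _ ⟨b, hb, rfl⟩
  have hUpow {n : ℕ} {y : Y} (hy : y ∈ U n) : (1 / 2 : ℝ) ^ (n + 1) • y ∈ U n :=
    (hU n).smul_mem hy (by positivity) (pow_le_one₀ (by norm_num) (by norm_num))
  obtain ⟨w, hwR, hw⟩ := exists_geometric_approximation hR hb
  choose e he hew using hwR
  obtain ⟨-, a, ha⟩ := hUsum _ fun n => hUpow (he n).2
  refine ⟨(a, (1 / 2 : ℝ) • b), hWc.closure_subset ?_, rfl⟩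
  rw [mem_closure_iff_nhds_basis ((𝓝 a).basis_sets.prod_nhds (𝓝 _).basis_sets)]
  rintro ⟨N, M⟩ ⟨hN, hM⟩
  let s (n : ℕ) : Y × Z := ∑ k ∈ Finset.range n, (1 / 2 : ℝ) ^ (k + 1) • e k
  have hM' (n : ℕ) : ∃ d ∈ W, d.1 ∈ U n ∧ (s n + (1 / 2 : ℝ) ^ (n + 1) • d).2 ∈ M := by
    obtain ⟨c, hc, hcb⟩ := hw n
    have hlim : Tendsto (fun c => (s n).2 + (1 / 2 : ℝ) ^ (n + 1) • c) (𝓝 c)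
        (𝓝 ((1 / 2 : ℝ) • b)) :=
      Continuous.tendsto' (by fun_prop) _ _ (by simpa [s, Prod.snd_sum, hew] using hcb)
    obtain ⟨_, hdM, d, ⟨hdW, hdU⟩, rfl⟩ := mem_closure_iff_nhds.1 hc _ (hlim hM)
    exact ⟨d, hdW, hdU, hdM⟩
  choose d hdW hdU hdM using hM'
  have hfst : Tendsto (fun n => (s n + (1 / 2 : ℝ) ^ (n + 1) • d n).1) atTop (𝓝 a) := by
    simpa [s, Prod.fst_sum] using ha.add (hUsum _ fun n => hUpow (hdU n)).1
  obtain ⟨n, hn⟩ := (hfst.eventually hN).exists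
  refine ⟨s n + (1 / 2 : ℝ) ^ (n + 1) • d n, ?_, hn, hdM n⟩
  rw [pow_succ, mul_smul]
  exact geometric_sum_add_smul_mem hW (fun k => (he k).1) n
    (hW.smul_mem_of_zero_mem h0 (hdW n) ⟨by norm_num, by norm_num⟩)

variable [UniformSpace Y] [IsUniformAddGroup Y] [ContinuousSMul ℝ Y] [LocallyConvexSpace ℝ Y]
  [FirstCountableTopology Y] [CompleteSpace Y] [TopologicalSpace Z] [IsTopologicalAddGroup Z]
  [ContinuousSMul ℝ Z] [BarrelledSpace ℝ Z]

theorem image_snd_mem_nhds_zero (hW : Convex ℝ W) (hWc : IsClosed W) (h0 : (0 : Y × Z) ∈ W)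
    (hcore : 0 ∈ core (Prod.snd '' W)) : Prod.snd '' W ∈ 𝓝 0 := by
  obtain ⟨U, hU, hUsum⟩ := exists_convex_nhds_zero_forall_tendsto_sum (Y := Y)
  have hstar (n : ℕ) : StarConvex ℝ 0 (U n) := (hU n).2.starConvex (mem_of_mem_nhds (hU n).1)
  have hR (n : ℕ) : closure (Prod.snd '' (W ∩ Prod.fst ⁻¹' U n)) ∈ 𝓝 0 := by
    have hconv : Convex ℝ (Prod.snd '' (W ∩ Prod.fst ⁻¹' U n)) :=
      (hW.inter ((hU n).2.linear_preimage (.fst ℝ Y Z))).linear_image (.snd ℝ Y Z)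
    exact mem_interior_iff_mem_nhds.1 <| core_subset_interior_of_isClosed hconv.closure
      isClosed_closure <| core_mono subset_closure <|
        zero_mem_core_image_snd_inter hW h0 hcore (hU n).1
  exact mem_of_superset ((set_smul_mem_nhds_zero_iff (by norm_num)).2 (hR 0))
    (half_smul_closure_image_snd_subset hW hWc h0 hstar hUsum hR)

/-- The Robinson–Ursescu theorem. -/
theorem core_image_snd_subset_interior (hW : Convex ℝ W) (hWc : IsClosed W) :
    core (Prod.snd '' W) ⊆ interior (Prod.snd '' W) := by
  intro z hz
  obtain ⟨p, hp, rfl⟩ := core_subset hz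
  have himage : Prod.snd '' ((p + ·) ⁻¹' W) = (p.2 + ·) ⁻¹' (Prod.snd '' W) := by
    ext z
    constructor
    · rintro ⟨q, hq, rfl⟩
      exact ⟨p + q, hq, rfl⟩
    · rintro ⟨q, hq, hqz⟩
      exact ⟨q - p, by simpa using hq, by simp [hqz]⟩
  have h := image_snd_mem_nhds_zero (hW.translate_preimage_right p)
    (hWc.preimage (continuous_const_add p)) (by simpa using hp)
    (by rw [himage]; simpa [mem_core] using mem_core.1 hz)
  rwa [mem_interior_iff_mem_nhds, ← map_add_left_nhds_zero, mem_map, ← himage]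

end RobinsonUrsescu

section UpwardClosed

variable {E : Type*} [AddCommGroup E] [Module ℝ E] {A : Set (E × ℝ)}

theorem mem_convexHull_union_zero {B : Set E} (hB : Convex ℝ B) (hne : B.Nonempty) {x : E} :
    x ∈ convexHull ℝ (B ∪ {0}) ↔ ∃ t ∈ Icc (0 : ℝ) 1, ∃ a ∈ B, t • a = x := by
  rw [union_singleton, convexHull_insert hne, hB.convexHull_eq, convexJoin_singleton_left]
  simp only [mem_iUnion₂, segment_eq_image, mem_image, smul_zero, zero_add, exists_prop]
  tauto

theorem mk_mem_core_of_lt (hA : Convex ℝ A)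
    (hup : ∀ ⦃z r r'⦄, (z, r) ∈ A → r ≤ r' → (z, r') ∈ A) {z : E} {r r' : ℝ}
    (hz : z ∈ core (Prod.fst '' A)) (hzr : (z, r) ∈ A) (hr : r < r') : (z, r') ∈ core A := by
  refine mem_core.2 fun ⟨w, s⟩ => ?_
  obtain ⟨t, ht, ⟨_, ρ⟩, hρ, rfl⟩ := mem_core.1 hz w
  -- A convex combination with small weight `θ` on `(z + t w, ρ)` raises the height `r` by less
  -- than the slack `r' - r`.
  obtain ⟨δ, hδ, hδlt⟩ := exists_pos_mul_lt (sub_pos.2 hr) |ρ - r - t * s|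
  set θ := min δ 1
  have hθ : 0 < θ := lt_min hδ one_pos
  have hθ1 : θ ≤ 1 := min_le_right _ _
  have hslack : θ * (ρ - r - t * s) ≤ r' - r := calc
    θ * (ρ - r - t * s) ≤ δ * |ρ - r - t * s| :=
      (mul_le_mul_of_nonneg_left (le_abs_self _) hθ.le).trans
        (mul_le_mul_of_nonneg_right (min_le_left _ _) (abs_nonneg _))
    _ ≤ r' - r := by rw [mul_comm]; exact hδlt.le
  have hmem : (z + (θ * t) • w, (1 - θ) * r + θ * ρ) ∈ A := by
    rw [show z + (θ * t) • w = (1 - θ) • z + θ • (z + t • w) by module]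
    exact hA hzr hρ (sub_nonneg.2 hθ1) hθ.le (sub_add_cancel 1 θ)
  have hle : (1 - θ) * r + θ * ρ ≤ r' + θ * t * s := by linarith
  exact ⟨θ * t, by positivity, hup hmem hle⟩

variable [TopologicalSpace E]

theorem core_image_fst_subset_interior (hA : Convex ℝ A)
    (hup : ∀ ⦃z r r'⦄, (z, r) ∈ A → r ≤ r' → (z, r') ∈ A) (hint : core A ⊆ interior A) :
    core (Prod.fst '' A) ⊆ interior (Prod.fst '' A) := by
  intro z hz
  obtain ⟨⟨z, r⟩, hzr, rfl⟩ := core_subset hz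
  have hmem := hint (mk_mem_core_of_lt hA hup hz hzr (lt_add_one r))
  exact isOpenMap_fst.image_interior_subset A ⟨_, hmem, rfl⟩

theorem zero_notMem_qri_convexHull_union_zero [IsTopologicalAddGroup E] [ContinuousSMul ℝ E]
    (hA : Convex ℝ A) (hup : ∀ ⦃z r r'⦄, (z, r) ∈ A → r ≤ r' → (z, r') ∈ A)
    (hint : core A ⊆ interior A) (h0 : 0 ∈ core (Prod.fst '' A))
    (hnonneg : ∀ r, (0, r) ∈ A → 0 ≤ r) : 0 ∉ qri (convexHull ℝ (A ∪ {0})) := by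
  intro hqri
  obtain ⟨⟨_, r⟩, hr, rfl⟩ := core_subset h0
  have hintA : (interior A).Nonempty :=
    ⟨_, hint (mk_mem_core_of_lt hA hup h0 hr (lt_add_one r))⟩
  have hAhull : A ⊆ convexHull ℝ (A ∪ {0}) := subset_union_left.trans (subset_convexHull ℝ _)
  have hcore : 0 ∈ core (convexHull ℝ (A ∪ {0})) := interior_subset_core <|
    qri_subset_interior (convex_convexHull ℝ _) (hintA.mono (interior_mono hAhull)) hqri
  -- Some `(0, -t)` with `t > 0` is then a multiple `a • (z, s)` of a point of `A`.
  obtain ⟨t, ht, htmem⟩ := mem_core.1 hcore (0, -1)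
  obtain ⟨a, ⟨ha, -⟩, ⟨z, s⟩, hzs, heq⟩ := (mem_convexHull_union_zero hA ⟨_, hr⟩).1 htmem
  obtain ⟨haz, has⟩ : a • z = 0 ∧ a * s = -t := by simpa using heq
  have ha0 : a ≠ 0 := by
    rintro rfl
    linarith
  obtain rfl : z = 0 := (smul_eq_zero.1 haz).resolve_left ha0
  linarith [mul_nonneg ha (hnonneg s hzs)]

end UpwardClosed

section JointEpigraph

variable {X Z : Type*} [AddCommGroup Z] [Module ℝ Z] {C : PointedCone ℝ Z} {S : Set X}
  {f : X → EReal} {g : X → WithTop Z} {v : ℝ}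

/-- The epigraph over `S` of the joint map `x ↦ (g x, f x - v)` with respect to the cone
`C × [0, ∞)`, encoded as the set of the triples `(x, (z, r))`; the values `g x = ∞` and
`f x = +∞` contribute no points. -/
def jointEpigraph (C : PointedCone ℝ Z) (S : Set X) (f : X → EReal) (g : X → WithTop Z) (v : ℝ) :
    Set (X × (Z × ℝ)) :=
  {p | p.1 ∈ S ∧ f p.1 ≤ ((p.2.2 + v : ℝ) : EReal) ∧ (p.1, p.2.1) ∈ epiC C g}

theorem mem_epiC {x : X} {z : Z} : (x, z) ∈ epiC C g ↔ ∃ y : Z, g x = y ∧ z - y ∈ C := by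
  simp only [epiC, LeC, mem_ofPred_eq, WithTop.coe_ne_top, false_or]
  constructor
  · rintro ⟨y, z', hy, hz, h⟩
    exact ⟨y, hy, by rwa [WithTop.coe_injective hz]⟩
  · rintro ⟨y, hy, h⟩
    exact ⟨y, z, hy, rfl, h⟩

theorem isClosed_jointEpigraph [TopologicalSpace X] [TopologicalSpace Z] (v : ℝ)
    (hS : IsClosed S) (hf : LowerSemicontinuous f) (hg : IsCEpiClosed C g) :
    IsClosed (jointEpigraph C S f g v) :=
  (hS.preimage continuous_fst).inter <|
    (hf.isClosed_epigraph.preimage <| continuous_fst.prodMk <|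
      continuous_coe_real_ereal.comp (continuous_snd.snd.add continuous_const)).inter <|
    hg.preimage (continuous_fst.prodMk continuous_snd.fst)

theorem conicExtension_eq_image_snd (hbot : ∀ x, ⊥ < f x) :
    conicExtension C S f g v = Prod.snd '' jointEpigraph C S f g v := by
  ext ⟨w, r⟩
  constructor
  · rintro ⟨x, ⟨⟨hxf, hxS⟩, -⟩, y, hy, z, hz, ε, hε, rfl : w = y + z, hr : (r : EReal) = _⟩
    refine ⟨(x, y + z, r), ⟨hxS, ?_, mem_epiC.2 ⟨y, hy, by simpa using hz⟩⟩, rfl⟩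
    change f x ≤ ((r + v : ℝ) : EReal)
    lift f x to ℝ using ⟨hxf.ne, (hbot x).ne'⟩ with a
    norm_cast at hr ⊢
    linarith
  · rintro ⟨⟨x, _, _⟩, ⟨hxS, hxf, hx⟩, ⟨⟩⟩
    change f x ≤ ((r + v : ℝ) : EReal) at hxf
    obtain ⟨y, hy, hyw⟩ := mem_epiC.1 hx
    have hxdom : f x < ⊤ := hxf.trans_lt (EReal.coe_lt_top _)
    have hxr : ∃ ε : ℝ, 0 ≤ ε ∧ (r : EReal) = f x - v + ε := by
      lift f x to ℝ using ⟨hxdom.ne, (hbot x).ne'⟩ with a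
      norm_cast at hxf ⊢
      exact ⟨r + v - a, by linarith, by ring⟩
    obtain ⟨ε, hε, hr⟩ := hxr
    exact ⟨x, ⟨⟨hxdom, hxS⟩, y, hy⟩, y, hy, w - y, hyw, ε, hε, by simp, hr⟩

theorem constraintRange_eq_image_fst (hbot : ∀ x, ⊥ < f x) :
    constraintRange C S f g = Prod.fst '' conicExtension C S f g v := by
  ext w
  constructor
  · rintro ⟨y, ⟨x, hx, hy⟩, z, hz, rfl⟩
    have hxf : f x = ((f x).toReal : EReal) := (EReal.coe_toReal hx.1.1.ne (hbot x).ne').symm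
    exact ⟨(y + z, (f x).toReal - v), ⟨x, hx, y, hy, z, hz, 0, le_rfl, rfl, by
      rw [hxf]; simp⟩, rfl⟩
  · rintro ⟨_, ⟨x, hx, y, hy, z, hz, -, -, hw, -⟩, rfl⟩
    exact hw ▸ add_mem_add ⟨x, hx, hy⟩ hz

theorem mk_mem_conicExtension_of_le {z : Z} {r r' : ℝ} (h : (z, r) ∈ conicExtension C S f g v)
    (hr : r ≤ r') : (z, r') ∈ conicExtension C S f g v := by
  obtain ⟨x, hx, y, hy, c, hc, ε, hε, hz, hxr⟩ := h
  refine ⟨x, hx, y, hy, c, hc, ε + (r' - r), add_nonneg hε (sub_nonneg.2 hr), hz, ?_⟩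
  rw [EReal.coe_add, ← add_assoc, ← hxr]
  norm_cast
  ring

theorem nonneg_of_zero_mk_mem_conicExtension (hv : primalValue C S f g = v) {r : ℝ}
    (h : (0, r) ∈ conicExtension C S f g v) : 0 ≤ r := by
  obtain ⟨x, hx, y, hy, c, hc, ε, hε, hyc, hr⟩ := h
  have hfeas : x ∈ feasible C S g :=
    ⟨hx.1.2, y, by simpa [neg_eq_of_add_eq_zero_right hyc.symm] using hc, hy⟩
  have hvx : (v : EReal) ≤ f x := hv ▸ biInf_le f hfeas
  have h0 : (0 : EReal) ≤ r := calc
    (0 : EReal) ≤ f x - v := by simpa using EReal.sub_le_sub hvx (le_refl (v : EReal))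
    _ ≤ f x - v + ε := le_add_of_nonneg_right (by exact_mod_cast hε)
    _ = r := hr.symm
  exact_mod_cast h0

theorem zero_mem_interior_constraintRange_of_RC1 [TopologicalSpace Z] [IsTopologicalAddGroup Z]
    (h : RC1 C S f g) : 0 ∈ interior (constraintRange C S f g) := by
  obtain ⟨x, hx, z, hz, hxz⟩ := h
  exact subset_interior_add_right
    ⟨z, ⟨x, ⟨hx, z, hxz⟩, hxz⟩, -z, hz, add_neg_cancel z⟩

variable [AddCommGroup X] [Module ℝ X]

theorem IsConvex.convex_epigraph (hf : IsConvex f) (hbot : ∀ x, ⊥ < f x) :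
    Convex ℝ {p : X × ℝ | f p.1 ≤ p.2} := by
  rintro ⟨x, r⟩ (hx : f x ≤ r) ⟨y, s⟩ (hy : f y ≤ s) a b ha hb hab
  obtain rfl : b = 1 - a := by linarith
  refine (hf x y a ⟨ha, sub_nonneg.1 hb⟩).trans ?_
  lift f x to ℝ using ⟨(hx.trans_lt (EReal.coe_lt_top r)).ne, (hbot x).ne'⟩ with p
  lift f y to ℝ using ⟨(hy.trans_lt (EReal.coe_lt_top s)).ne, (hbot y).ne'⟩ with q
  have hpq : a * p + (1 - a) * q ≤ a * r + (1 - a) * s := by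
    norm_cast at hx hy
    gcongr
  simp only [convMul, EReal.coe_ne_top, if_false, convAdd, ← EReal.coe_mul, or_self,
    ← EReal.coe_add]
  exact_mod_cast hpq

theorem IsCConvex.convex_epiC (hg : IsCConvex C g) : Convex ℝ (epiC C g) := by
  rintro ⟨x, z⟩ hx ⟨x', z'⟩ hx' a b ha hb hab
  obtain ⟨y, hy, hyz⟩ := mem_epiC.1 hx
  obtain ⟨y', hy', hyz'⟩ := mem_epiC.1 hx'
  obtain rfl : b = 1 - a := by linarith
  have hcomb : (a • x + (1 - a) • x', a • y + (1 - a) • y') ∈ epiC C g := by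
    have h := hg x x' a ⟨ha, sub_nonneg.1 hb⟩
    rwa [hy, hy'] at h
  obtain ⟨w, hw, hwC⟩ := mem_epiC.1 hcomb
  refine mem_epiC.2 ⟨w, hw, ?_⟩
  convert! C.add_mem hwC (C.add_mem (C.smul_mem ha hyz) (C.smul_mem hb hyz')) using 1
  simp only [Prod.smul_snd]
  module

theorem convex_jointEpigraph (v : ℝ) (hS : Convex ℝ S) (hf : IsConvex f) (hbot : ∀ x, ⊥ < f x)
    (hg : IsCConvex C g) : Convex ℝ (jointEpigraph C S f g v) := by
  rintro ⟨x, z, r⟩ ⟨hxS, hxf, hxg⟩ ⟨x', z', r'⟩ ⟨hxS', hxf', hxg'⟩ a b ha hb hab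
  refine ⟨hS hxS hxS' ha hb hab, ?_, hg.convex_epiC hxg hxg' ha hb hab⟩
  have hepi : f (a • x + b • x') ≤ ((a * (r + v) + b * (r' + v) : ℝ) : EReal) :=
    hf.convex_epigraph hbot (x := (x, r + v)) hxf (y := (x', r' + v)) hxf' ha hb hab
  convert! hepi using 2
  simp only [Prod.snd_add, Prod.smul_snd, smul_eq_mul]
  linear_combination v * hab.symm

theorem convex_conicExtension (hS : Convex ℝ S) (hf : IsConvex f) (hbot : ∀ x, ⊥ < f x)
    (hg : IsCConvex C g) : Convex ℝ (conicExtension C S f g v) := by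
  rw [conicExtension_eq_image_snd hbot]
  exact (convex_jointEpigraph v hS hf hbot hg).linear_image (.snd ℝ X (Z × ℝ))

theorem core_conicExtension_subset_interior [UniformSpace X] [FrechetSpace X] [UniformSpace Z]
    [FrechetSpace Z] (hS : Convex ℝ S) (hSc : IsClosed S) (hf : IsConvex f)
    (hbot : ∀ x, ⊥ < f x) (hfl : LowerSemicontinuous f) (hg : IsCConvex C g)
    (hgc : IsCEpiClosed C g) :
    core (conicExtension C S f g v) ⊆ interior (conicExtension C S f g v) := by
  have : (uniformity Z).IsCountablyGenerated := IsUniformAddGroup.uniformity_countably_generated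
  rw [conicExtension_eq_image_snd hbot]
  exact core_image_snd_subset_interior (convex_jointEpigraph v hS hf hbot hg)
    (isClosed_jointEpigraph v hSc hfl hgc)

end JointEpigraph

end LagrangeQri

theorem proposition6p4 {X Z : Type*}
    [AddCommGroup X] [Module ℝ X] [UniformSpace X] [FrechetSpace X]
    [AddCommGroup Z] [Module ℝ Z] [UniformSpace Z] [FrechetSpace Z]
    (C : PointedCone ℝ Z) (S : Set X) (f : X → EReal) (g : X → WithTop Z)
    (hS_nonempty : S.Nonempty) (hS_convex : Convex ℝ S) (hS_closed : IsClosed S)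
    (hf_proper : IsProper f) (hf_convex : IsConvex f) (hf_lsc : LowerSemicontinuous f)
    (hg_proper : (vdom g).Nonempty) (hg_convex : IsCConvex C g) (hg_closed : IsCEpiClosed C g)
    (h_feasible : (dom f ∩ S ∩ vpreimage g (-(C : Set Z))).Nonempty)
    (v : ℝ) (hv : primalValue C S f g = (v : EReal)) :
    (RC1 C S f g → RC2 C S f g) ∧
    (RC2 C S f g ↔ RC3 C S f g) ∧
    (RC3 C S f g → RC6 C S f g v) ∧
    (RC6 C S f g v ↔ RC7 C S f g v) := by
  have hbot := hf_proper.2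
  have hE : Convex ℝ (conicExtension C S f g v) :=
    convex_conicExtension hS_convex hf_convex hbot hg_convex
  have hint := core_conicExtension_subset_interior (v := v) hS_convex hS_closed hf_convex hbot
    hf_lsc hg_convex hg_closed
  have hM : constraintRange C S f g = Prod.fst '' conicExtension C S f g v :=
    constraintRange_eq_image_fst hbot
  refine ⟨fun h => ⟨‹_›, ‹_›, hS_closed, hf_lsc, hg_closed,
    zero_mem_interior_constraintRange_of_RC1 h⟩, ⟨?_, ?_⟩, ?_, ?_⟩
  · rintro ⟨hX, hZ, hS, hf, hg, h⟩
    exact ⟨hX, hZ, hS, hf, hg, interior_subset_core h⟩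
  · rintro ⟨hX, hZ, hS, hf, hg, h⟩
    refine ⟨hX, hZ, hS, hf, hg, ?_⟩
    rw [hM] at h ⊢
    exact core_image_fst_subset_interior hE (fun _ _ _ => mk_mem_conicExtension_of_le) hint h
  · rintro ⟨-, -, -, -, -, h⟩
    exact ⟨core_subset_qi h, zero_notMem_qri_convexHull_union_zero hE
      (fun _ _ _ => mk_mem_conicExtension_of_le) hint (hM ▸ h)
      fun _ => nonneg_of_zero_mk_mem_conicExtension hv⟩
  · rw [RC6, RC7, mem_qi_iff_zero_mem_qi_sub_and_mem_qri, and_assoc]
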